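/- Let $G$ be a compact topological group. A $G$-space is a topological space with a (jointly) continuous action of $G$. A metrizable $G$-space $X$ is called a $G$-equivariant absolute extensor ($G$-AE) if for every metrizable $G$-space $Z$, every closed $G$-invariant subset $A\subset Z$ and every continuous $G$-equivariant map $f:A\to X$, there is a continuous $G$-equivariant map $F:Z\to X$ with $F|_A=f$. Let $L$ be a Banach $G$-space, i.e. a real Banach space with a continuous action of $G$ by linear isometries. Let $CB(L)$ be the set of all nonempty closed bounded convex subsets of $L$ with the Hausdorff metric $$d_H(A,B)=\inf\{\varepsilon>0 : A\subset N(B,\varepsilon),\ B\subset N(A,\varepsilon)\},\qquad N(A,\varepsilon)=\{x\in L : d(x,A)<\varepsilon\},$$ where $d$ is the metric induced by the norm, and let $cc(L)\subset CB(L)$ be the subspace of all nonempty compact convex subsets of $L$. Let $G$ act on both by $gA=\{ga : a\in A\}$. Then $cc(L)$ is a $G$-AE (in particular, the action of $G$ on $cc(L)$ is continuous). If, moreover, the action $G\times CB(L)\to CB(L)$ is continuous, then $CB(L)$ is also a $G$-AE. -/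

import Mathlib

open scoped Pointwise

universe w u v

/-- `CB L`: the nonempty closed bounded convex subsets of a real normed space `L`. -/
structure CB (L : Type*) [NormedAddCommGroup L] [NormedSpace ℝ L] where
  /-- The underlying set. -/
  carrier : Set L
  convex' : Convex ℝ carrier
  isClosed' : IsClosed carrier
  isBounded' : Bornology.IsBounded carrier
  nonempty' : carrier.Nonempty

namespace CB

variable {L : Type*} [NormedAddCommGroup L] [NormedSpace ℝ L]

instance : SetLike (CB L) L where
  coe := CB.carrier
  coe_injective A B h := by
    cases A
    cases B
    congr

theorem hausdorffEDist_ne_top (A B : CB L) :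
    Metric.hausdorffEDist (A : Set L) (B : Set L) ≠ ⊤ :=
  Metric.hausdorffEDist_ne_top_of_nonempty_of_bounded
    A.nonempty' B.nonempty' A.isBounded' B.isBounded'

/-- The Hausdorff metric on `CB L`. -/
noncomputable instance : MetricSpace (CB L) where
  dist A B := Metric.hausdorffDist (A : Set L) (B : Set L)
  dist_self _ := Metric.hausdorffDist_self_zero
  dist_comm _ _ := Metric.hausdorffDist_comm
  dist_triangle A B _ := Metric.hausdorffDist_triangle (hausdorffEDist_ne_top A B)
  eq_of_dist_eq_zero {A B} h := SetLike.coe_injective <|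
    (A.isClosed'.hausdorffDist_zero_iff_eq B.isClosed' (hausdorffEDist_ne_top A B)).1 h

variable {G : Type*} [Group G] [DistribMulAction G L] [SMulCommClass G ℝ L]
  [IsIsometricSMul G L]

/-- The induced action `g • A = {g • a | a ∈ A}` on closed bounded convex sets. -/
instance : MulAction G (CB L) where
  smul g A :=
    { carrier := g • (A : Set L)
      convex' := A.convex'.is_linear_image
        ⟨fun x y => smul_add g x y, fun c x => smul_comm g c x⟩
      isClosed' := A.isClosed'.smul g
      isBounded' := by
        have h := (LipschitzWith.of_edist_le (f := fun x : L => g • x)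
          (fun x y => (edist_smul_left g x y).le)).isBounded_image A.isBounded'
        exact h
      nonempty' := A.nonempty'.smul_set }
  one_smul A := SetLike.coe_injective (one_smul G (A : Set L))
  mul_smul g h A := SetLike.coe_injective (mul_smul g h (A : Set L))

theorem coe_smul (g : G) (A : CB L) : ((g • A : CB L) : Set L) = g • (A : Set L) := rfl

end CB

namespace ConvexBody

variable {L : Type*} [NormedAddCommGroup L] [NormedSpace ℝ L]
  {G : Type*} [Group G] [DistribMulAction G L] [SMulCommClass G ℝ L] [IsIsometricSMul G L]

/-- The induced action `g • A = {g • a | a ∈ A}` on `cc(L)`, the nonempty compact convex sets,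
which is Mathlib's `ConvexBody L`; its metric is the Hausdorff metric. -/
instance inducedMulAction : MulAction G (ConvexBody L) where
  smul g A :=
    { carrier := g • (A : Set L)
      convex' := A.convex'.is_linear_image
        ⟨fun x y => smul_add g x y, fun c x => smul_comm g c x⟩
      isCompact' := A.isCompact'.smul g
      nonempty' := A.nonempty'.smul_set }
  one_smul A := SetLike.coe_injective (one_smul G (A : Set L))
  mul_smul g h A := SetLike.coe_injective (mul_smul g h (A : Set L))

theorem coe_induced_smul (g : G) (A : ConvexBody L) :
    ((g • A : ConvexBody L) : Set L) = g • (A : Set L) := rfl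

end ConvexBody

/-- `X` is a `G`-equivariant absolute extensor: `X` is a metrizable `G`-space, and every continuous
equivariant map into `X` from an invariant closed subset `A` of a metrizable `G`-space `Z`
extends to a continuous equivariant map on all of `Z`. A `G`-space is a topological space with a
(jointly) continuous action of `G`. The test spaces `Z` range over the universe `w`, which is
independent of those of `G` and `X`. -/
structure IsGAE (G : Type u) [Group G] [TopologicalSpace G]
    (X : Type v) [TopologicalSpace X] [MulAction G X] : Prop where
  metrizable : TopologicalSpace.MetrizableSpace X
  continuousSMul : ContinuousSMul G X
  exists_extension : ∀ (Z : Type w) [TopologicalSpace Z] [TopologicalSpace.MetrizableSpace Z]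
    [MulAction G Z] [ContinuousSMul G Z] (A : Set Z) (_ : IsClosed A)
    (hA : ∀ (g : G), ∀ a ∈ A, g • a ∈ A) (f : A → X) (_ : Continuous f)
    (_ : ∀ (g : G) (a : A), f ⟨g • (a : Z), hA g a a.2⟩ = g • f a),
    ∃ F : Z → X, Continuous F ∧ (∀ (g : G) (z : Z), F (g • z) = g • F z) ∧ ∀ a : A, F a = f a

/-!
Both spaces are, up to isometry, complete convex subsets of a Banach space on which every `g : G`
acts by a continuous linear map, and any such `G`-space is a `G`-AE.

The embedding sends `A` to its support function `φ ↦ sup φ(A)` on the closed unit ball of the dual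
of `L`. By the Hahn-Banach theorem the sup distance of support functions is the Hausdorff distance
(`CB.isometry_supportFn`); the support function of (the closure of) `a A + b B` is the combination
of those of `A` and `B`, so the range is convex (`CB.convex_range_supportFn`); and `g` acts by
precomposition with `φ ↦ φ ∘ g`, which is linear (`CB.supportFn_smul`). Completeness is inherited
from the hyperspaces of closed and of nonempty compact sets.

For such a convex subset, Dugundji's theorem (`exists_continuous_extension_mem_convex`) extends a
given equivariant map `f` to a continuous, not yet equivariant, map `e`. Averaging over the
normalized Haar measure, `F z = ∫ g • e (g⁻¹ • z) dg`, makes it equivariant and does not change it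
where it is already equivariant; the integral stays in the convex set because that set is closed
(`IsGAE.of_isometry_of_convex_range`). The averaged map depends continuously on `z` only because
the action of `G` on the set is jointly continuous. For compact convex sets this joint continuity
follows from uniform convergence of `x ↦ g • x` on compact sets; for `CB L` it is assumed.
-/

open Set Metric Filter Topology MeasureTheory

/-! ### Extension of maps into convex sets -/

/-- **Dugundji's extension theorem**: a continuous map from a closed subset of a metric space into
a convex set extends to the whole space with values in that set. Off `A` the extension at `z` is
chosen, by a partition of unity, in the convex hull of the values of `f` at the points of `A` whose
distance to `z` is less than twice the distance from `z` to `A`. -/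
theorem exists_continuous_extension_mem_convex {Z E : Type*} [MetricSpace Z]
    [NormedAddCommGroup E] [NormedSpace ℝ E] {C : Set E} (hC : Convex ℝ C) (hCne : C.Nonempty)
    {A : Set Z} (hA : IsClosed A) (f : A → E) (hf : Continuous f) (hfC : ∀ a, f a ∈ C) :
    ∃ F : Z → E, Continuous F ∧ (∀ z, F z ∈ C) ∧ ∀ a : A, F a = f a := by
  classical
  obtain rfl | hne := A.eq_empty_or_nonempty
  · obtain ⟨c, hc⟩ := hCne
    exact ⟨fun _ => c, continuous_const, fun _ => hc, fun a => a.2.elim⟩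
  have hpos : ∀ z ∉ A, 0 < infDist z A := fun z hz => (hA.notMem_iff_infDist_pos hne).1 hz
  let t : (Aᶜ : Set Z) → Set E := fun z =>
    convexHull ℝ (f '' {a | dist (z : Z) a < 2 * infDist (z : Z) A})
  obtain ⟨h, ht⟩ : ∃ h : C((Aᶜ : Set Z), E), ∀ z, h z ∈ t z := by
    refine exists_continuous_forall_mem_convex_of_local_const (fun _ => convex_convexHull ℝ _)
      fun z => ?_
    have hz := hpos z z.2
    obtain ⟨a, ha, hza⟩ := (infDist_lt_iff hne).1 (show infDist (z : Z) A < 2 * infDist (z : Z) A by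
      linarith)
    refine ⟨f ⟨a, ha⟩, ?_⟩
    have hev : ∀ᶠ y : (Aᶜ : Set Z) in 𝓝 z, dist (y : Z) a < 2 * infDist (y : Z) A :=
      ((continuous_subtype_val.dist continuous_const).continuousAt).eventually_lt
        ((continuous_const.mul ((continuous_infDist_pt A).comp
          continuous_subtype_val)).continuousAt) hza
    filter_upwards [hev] with y hy
    exact subset_convexHull ℝ _ ⟨⟨a, ha⟩, hy, rfl⟩
  let F : Z → E := fun z => if hz : z ∈ A then f ⟨z, hz⟩ else h ⟨z, hz⟩
  have hFA : ∀ a : A, F a = f a := fun a => dif_pos a.2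
  have hFc : ∀ z : (Aᶜ : Set Z), F z = h z := fun z => dif_neg z.2
  refine ⟨F, continuous_iff_continuousAt.2 fun z => ?_, fun z => ?_, hFA⟩
  · by_cases hz : z ∈ A
    · rw [Metric.continuousAt_iff, hFA ⟨z, hz⟩]
      intro ε hε
      obtain ⟨δ, hδ, H⟩ := Metric.continuousAt_iff.1 (hf.continuousAt (x := ⟨z, hz⟩)) ε hε
      refine ⟨δ / 3, by positivity, fun {y} hy => ?_⟩
      by_cases hyA : y ∈ A
      · rw [hFA ⟨y, hyA⟩]
        exact H (show dist y z < δ by linarith)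
      · rw [hFc ⟨y, hyA⟩]
        refine convexHull_min ?_ (convex_ball (f ⟨z, hz⟩) ε) (ht ⟨y, hyA⟩)
        rintro _ ⟨a, ha, rfl⟩
        refine H (show dist (a : Z) z < δ from ?_)
        -- the point `a` is within `2 * dist y z` of `y`, hence within `3 * dist y z` of `z`
        have h1 : dist y (a : Z) < 2 * infDist y A := ha
        have h2 : infDist y A ≤ dist y z := infDist_le_dist_of_mem hz
        have h3 := dist_triangle_left (a : Z) z y
        linarith
    · have : ContinuousOn F Aᶜ := by
        rw [continuousOn_iff_continuous_domRestrict]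
        exact h.continuous.congr fun z => (hFc z).symm
      exact this.continuousAt (hA.isOpen_compl.mem_nhds hz)
  · by_cases hz : z ∈ A
    · rw [hFA ⟨z, hz⟩]
      exact hfC _
    · rw [hFc ⟨z, hz⟩]
      refine convexHull_min ?_ hC (ht ⟨z, hz⟩)
      rintro _ ⟨a, -, rfl⟩
      exact hfC a

/-! ### Averaging over the group -/

/-- A complete `G`-space that embeds isometrically onto a convex set, with each `g` acting as the
restriction of a continuous linear map `T g`, is a `G`-AE. The maps `T g` need not depend
continuously on `g`: they serve only to move `g` across the integral. -/
theorem IsGAE.of_isometry_of_convex_range {G : Type u} [Group G] [TopologicalSpace G]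
    [IsTopologicalGroup G] [CompactSpace G] {X : Type v} [MetricSpace X] [CompleteSpace X]
    [Nonempty X] [MulAction G X] [ContinuousSMul G X] {E : Type*} [NormedAddCommGroup E]
    [NormedSpace ℝ E] [CompleteSpace E] (ι : X → E) (hι : Isometry ι)
    (hconv : Convex ℝ (range ι)) (T : G → E →L[ℝ] E) (hT : ∀ g x, ι (g • x) = T g (ι x)) :
    IsGAE.{w} G X := by
  refine ⟨inferInstance, inferInstance, fun Z _ _ _ _ A hA hAinv f hf hfeq => ?_⟩
  let := TopologicalSpace.metrizableSpaceMetric Z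
  obtain ⟨F₀, hF₀, hF₀r, hF₀A⟩ := exists_continuous_extension_mem_convex hconv (range_nonempty ι)
    hA (ι ∘ f) (hι.continuous.comp hf) fun a => mem_range_self _
  choose e he using hF₀r
  have hec : Continuous e := hι.isEmbedding.continuous_iff.2 (hF₀.congr fun z => (he z).symm)
  have heA : ∀ a : A, e a = f a := fun a => hι.injective ((he a).trans (hF₀A a))
  borelize G
  let μ : Measure G := Measure.haarMeasure ⊤
  have : IsProbabilityMeasure μ := ⟨Measure.haarMeasure_self (K₀ := ⊤)⟩
  have hΦ : Continuous fun p : Z × G => ι (p.2 • e (p.2⁻¹ • p.1)) :=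
    hι.continuous.comp (continuous_snd.smul (hec.comp (continuous_snd.inv.smul continuous_fst)))
  let Φ : Z → C(G, E) := ContinuousMap.curry ⟨_, hΦ⟩
  have hΦc : Continuous Φ := ContinuousMap.continuous _
  have hint : ∀ φ : C(G, E), Integrable φ μ := fun φ =>
    φ.continuous.integrable_of_hasCompactSupport (HasCompactSupport.of_compactSpace _)
  have hI : LipschitzWith 1 fun φ : C(G, E) => ∫ g, φ g ∂μ := by
    refine LipschitzWith.of_dist_le_mul fun φ ψ => ?_
    rw [dist_eq_norm, ← integral_sub (hint φ) (hint ψ), dist_eq_norm]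
    simpa using norm_integral_le_of_norm_le_const (μ := μ) (f := fun g => φ g - ψ g)
      (C := ‖φ - ψ‖) (Eventually.of_forall fun g => (φ - ψ).norm_coe_le_norm g)
  have hmem : ∀ z, ∫ g, Φ z g ∂μ ∈ range ι := fun z =>
    hconv.integral_mem hι.isClosedEmbedding.isClosed_range
      (Eventually.of_forall fun g => mem_range_self _) (hint _)
  choose F hF using hmem
  -- equivariance is the substitution `g ↦ h * g`; on `A` the integrand is constant
  refine ⟨F, hι.isEmbedding.continuous_iff.2
    ((hI.continuous.comp hΦc).congr fun z => (hF z).symm), fun h z => hι.injective ?_,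
    fun a => hι.injective ?_⟩
  · rw [hT, hF, hF, ← (T h).integral_comp_comm (hint _),
      ← integral_mul_left_eq_self (fun g => Φ (h • z) g) h]
    refine integral_congr_ae (Eventually.of_forall fun g => ?_)
    change ι ((h * g) • e ((h * g)⁻¹ • h • z)) = T h (ι (g • e (g⁻¹ • z)))
    rw [← hT, mul_inv_rev, mul_smul, mul_smul, inv_smul_smul]
  · rw [hF]
    have : ∀ g, Φ a g = ι (f a) := fun g => by
      change ι (g • e (g⁻¹ • (a : Z))) = _
      have h1 : e (g⁻¹ • (a : Z)) = g⁻¹ • f a :=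
        (heA ⟨_, hAinv g⁻¹ a a.2⟩).trans (hfeq g⁻¹ a)
      rw [h1, smul_inv_smul]
    simp [this]

/-! ### Completeness of the space of closed bounded convex sets -/

namespace CB

variable {L : Type*} [NormedAddCommGroup L] [NormedSpace ℝ L]

/-- The closed set underlying an element of `CB L`. -/
def toCloseds (A : CB L) : TopologicalSpace.Closeds L := ⟨A, A.isClosed'⟩

theorem edist_eq (A B : CB L) : edist A B = hausdorffEDist (A : Set L) (B : Set L) := by
  rw [edist_dist]
  exact ENNReal.ofReal_toReal (hausdorffEDist_ne_top A B)

theorem isometry_toCloseds : Isometry (toCloseds : CB L → TopologicalSpace.Closeds L) :=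
  fun A B => (edist_eq A B).symm

/-- A Hausdorff limit of nonempty bounded convex sets is nonempty, bounded and convex. -/
theorem isClosed_range_toCloseds :
    IsClosed (range (toCloseds : CB L → TopologicalSpace.Closeds L)) := by
  refine isClosed_of_closure_subset fun C hC => ?_
  have key : ∀ ε > 0, ∃ A : CB L, hausdorffEDist (C : Set L) (A : Set L) < ENNReal.ofReal ε := by
    intro ε hε
    obtain ⟨_, ⟨A, rfl⟩, hA⟩ := EMetric.mem_closure_iff.1 hC _ (ENNReal.ofReal_pos.2 hε)
    exact ⟨A, hA⟩
  have hsub : ∀ ε, ∀ S T : Set L, hausdorffEDist S T < ENNReal.ofReal ε → S ⊆ thickening ε T := by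
    intro ε S T h x hx
    obtain ⟨y, hy, hxy⟩ := exists_edist_lt_of_hausdorffEDist_lt hx h
    exact (mem_thickening_iff_exists_edist_lt _ _).2 ⟨y, hy, hxy⟩
  obtain ⟨A₁, hA₁⟩ := key 1 one_pos
  refine ⟨⟨C, fun x hx y hy a b ha hb hab => ?_, C.isClosed,
    A₁.isBounded'.thickening.subset (hsub 1 _ _ hA₁), ?_⟩, rfl⟩
  · rw [← C.isClosed.closure_eq, Metric.mem_closure_iff]
    intro ε hε
    obtain ⟨A, hA⟩ := key (ε / 2) (half_pos hε)
    obtain ⟨z', hz', h1⟩ := mem_thickening_iff.1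
      (A.convex'.thickening (ε / 2) (hsub _ _ _ hA hx) (hsub _ _ _ hA hy) ha hb hab)
    obtain ⟨z, hz, h2⟩ := mem_thickening_iff.1 (hsub _ _ _ (hausdorffEDist_comm.trans_lt hA) hz')
    exact ⟨z, hz, (dist_triangle _ z' _).trans_lt (by linarith)⟩
  · obtain ⟨y, hy⟩ := A₁.nonempty'
    obtain ⟨x, hx, -⟩ := exists_edist_lt_of_hausdorffEDist_lt hy
      (hausdorffEDist_comm.trans_lt hA₁)
    exact ⟨x, hx⟩

instance [CompleteSpace L] : CompleteSpace (CB L) :=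
  (completeSpace_iff_isComplete_range isometry_toCloseds.isUniformInducing).2
    isClosed_range_toCloseds.isComplete

instance : Nonempty (CB L) :=
  ⟨⟨{0}, convex_singleton 0, isClosed_singleton, Bornology.isBounded_singleton,
    singleton_nonempty 0⟩⟩

/-! ### Support functions -/

variable (L) in
/-- The closed unit ball of the dual of `L`, with the norm topology. -/
abbrev DualBall : Type _ := closedBall (0 : StrongDual ℝ L) 1

theorem abs_apply_le_norm (φ : DualBall L) (x : L) : |φ.1 x| ≤ ‖x‖ := by
  simpa using φ.1.le_of_opNorm_le (mem_closedBall_zero_iff.1 φ.2) x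

theorem isLUB_sSup_image (A : CB L) (φ : DualBall L) :
    IsLUB (φ.1 '' A) (sSup (φ.1 '' A)) := by
  refine isLUB_csSup (A.nonempty'.image _) ?_
  obtain ⟨R, hR⟩ := A.isBounded'.exists_norm_le
  refine ⟨R, ?_⟩
  rintro _ ⟨x, hx, rfl⟩
  exact (le_abs_self _).trans ((abs_apply_le_norm φ x).trans (hR x hx))

theorem exists_lipschitzWith_sSup_image (A : CB L) :
    ∃ K, LipschitzWith K fun φ : DualBall L => sSup (φ.1 '' A) := by
  obtain ⟨R, hR0, hR⟩ := A.isBounded'.exists_pos_norm_le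
  refine ⟨⟨R, hR0.le⟩, LipschitzWith.of_le_add_mul _ fun φ ψ => ?_⟩
  refine (isLUB_sSup_image A φ).2 ?_
  rintro _ ⟨x, hx, rfl⟩
  have h1 : ψ.1 x ≤ sSup (ψ.1 '' A) := (isLUB_sSup_image A ψ).1 ⟨x, hx, rfl⟩
  have h2 : φ.1 x - ψ.1 x ≤ dist φ ψ * ‖x‖ := by
    rw [Subtype.dist_eq, dist_eq_norm]
    exact (le_abs_self _).trans ((φ.1 - ψ.1).le_opNorm x)
  have h3 : dist φ ψ * ‖x‖ ≤ dist φ ψ * R := mul_le_mul_of_nonneg_left (hR x hx) dist_nonneg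
  change _ ≤ _ + R * _
  linarith

theorem exists_norm_sSup_image_le (A : CB L) :
    ∃ R, ∀ φ : DualBall L, ‖sSup (φ.1 '' A)‖ ≤ R := by
  obtain ⟨R, hR⟩ := A.isBounded'.exists_norm_le
  have hb : ∀ φ : DualBall L, ∀ x ∈ A, |φ.1 x| ≤ R := fun φ x hx =>
    (abs_apply_le_norm φ x).trans (hR x hx)
  refine ⟨R, fun φ => abs_le.2 ⟨?_, ?_⟩⟩
  · obtain ⟨x, hx⟩ := A.nonempty'
    exact (abs_le.1 (hb φ x hx)).1.trans ((isLUB_sSup_image A φ).1 ⟨x, hx, rfl⟩)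
  · refine (isLUB_sSup_image A φ).2 ?_
    rintro _ ⟨x, hx, rfl⟩
    exact (abs_le.1 (hb φ x hx)).2

/-- The support function `φ ↦ sup {φ a | a ∈ A}` of a closed bounded convex set `A`, as a bounded
continuous function on the closed unit ball of the dual. -/
noncomputable def supportFn (A : CB L) : BoundedContinuousFunction (DualBall L) ℝ :=
  BoundedContinuousFunction.ofNormedAddCommGroup (fun φ => sSup (φ.1 '' A))
    (exists_lipschitzWith_sSup_image A).choose_spec.continuous
    (exists_norm_sSup_image_le A).choose (exists_norm_sSup_image_le A).choose_spec

theorem isLUB_supportFn (A : CB L) (φ : DualBall L) : IsLUB (φ.1 '' A) (supportFn A φ) :=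
  isLUB_sSup_image A φ

theorem supportFn_le_add_dist (A B : CB L) (φ : DualBall L) :
    supportFn A φ ≤ supportFn B φ + dist A B := by
  refine (isLUB_supportFn A φ).2 ?_
  rintro _ ⟨x, hx, rfl⟩
  rw [← sub_le_iff_le_add']
  refine le_of_forall_gt_imp_ge_of_dense fun r hr => ?_
  obtain ⟨y, hy, hxy⟩ := exists_dist_lt_of_hausdorffDist_lt hx hr (hausdorffEDist_ne_top A B)
  have h1 : φ.1 y ≤ supportFn B φ := (isLUB_supportFn B φ).1 ⟨y, hy, rfl⟩
  have h2 : φ.1 x - φ.1 y ≤ dist x y := by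
    rw [dist_eq_norm, ← map_sub]
    exact (le_abs_self _).trans (abs_apply_le_norm φ _)
  linarith

/-- If `x ∈ A` is at distance more than `r` from `B`, then a functional separating the ball of
radius `r` around `x` from `B` shows that the support functions differ by at least `r`. -/
theorem infDist_le_dist_supportFn (A B : CB L) {x : L} (hx : x ∈ A) :
    infDist x B ≤ dist (supportFn A) (supportFn B) := by
  refine le_of_forall_lt_imp_le_of_dense fun r hr => ?_
  obtain hr0 | hr0 := le_or_gt r 0
  · exact hr0.trans dist_nonneg
  have hdisj : Disjoint (ball x r) (B : Set L) :=
    (disjoint_ball_infDist (s := (B : Set L)) (x := x)).mono_left (ball_subset_ball hr.le)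
  obtain ⟨f, s, hfs, hsf⟩ :=
    geometric_hahn_banach_open (convex_ball x r) isOpen_ball B.convex' hdisj
  have hf0 : 0 < ‖f‖ := by
    refine norm_pos_iff.2 fun h0 => ?_
    obtain ⟨y, hy⟩ := B.nonempty'
    have h1 := hfs x (mem_ball_self hr0)
    have h2 := hsf y hy
    simp only [h0, zero_apply] at h1 h2
    linarith
  -- `f x + r * ‖f‖` is the supremum of `f` over the ball
  have hball : f x + r * ‖f‖ ≤ s := by
    have h1 : ‖f‖ ≤ (s - f x) / r := by
      refine le_of_forall_lt_imp_le_of_dense fun c hc => ?_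
      obtain ⟨v, hv, hcv⟩ := f.exists_lt_apply_of_lt_opNorm hc
      have hmem : ∀ w : L, ‖w‖ < 1 → f x + r * f w < s := fun w hw => by
        have h := hfs (x + r • w) (by
          rw [mem_ball_iff_norm, add_sub_cancel_left, norm_smul, Real.norm_of_nonneg hr0.le]
          exact mul_lt_of_lt_one_right hr0 hw)
        rwa [map_add, map_smul, smul_eq_mul] at h
      have habs : r * |f v| ≤ s - f x := by
        obtain h | h := abs_cases (f v)
        · rw [h.1]
          linarith [hmem v hv]
        · have := hmem (-v) (by rwa [norm_neg])
          rw [map_neg] at this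
          rw [h.1]
          linarith
      rw [le_div_iff₀ hr0]
      have := mul_le_mul_of_nonneg_left hcv.le hr0.le
      rw [Real.norm_eq_abs] at this
      linarith
    rw [le_div_iff₀ hr0] at h1
    linarith
  -- the sign turns `s ≤ f` on `B` into an upper bound for the support function of `B`
  let φ : DualBall L := ⟨-(‖f‖⁻¹ • f), by
    rw [mem_closedBall_zero_iff, norm_neg, norm_smul, norm_inv, norm_norm,
      inv_mul_cancel₀ hf0.ne']⟩
  have hφ : ∀ y, φ.1 y = -(‖f‖⁻¹ * f y) := fun y => rfl
  have hA : φ.1 x ≤ supportFn A φ := (isLUB_supportFn A φ).1 ⟨x, hx, rfl⟩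
  have hB : supportFn B φ ≤ φ.1 x - r := by
    refine (isLUB_supportFn B φ).2 ?_
    rintro _ ⟨y, hy, rfl⟩
    have h1 : ‖f‖⁻¹ * (f x + r * ‖f‖) ≤ ‖f‖⁻¹ * f y :=
      mul_le_mul_of_nonneg_left (hball.trans (hsf y hy)) (inv_nonneg.2 hf0.le)
    rw [mul_add, mul_comm r, inv_mul_cancel_left₀ hf0.ne'] at h1
    rw [hφ, hφ]
    linarith
  have hd := (le_abs_self _).trans (BoundedContinuousFunction.dist_coe_le_dist
    (f := supportFn A) (g := supportFn B) φ)
  linarith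

theorem isometry_supportFn : Isometry (supportFn (L := L)) := by
  refine Isometry.of_dist_eq fun A B => le_antisymm ?_ ?_
  · refine (BoundedContinuousFunction.dist_le dist_nonneg).2 fun φ => ?_
    have h1 := supportFn_le_add_dist A B φ
    have h2 := supportFn_le_add_dist B A φ
    rw [dist_comm] at h2
    exact abs_sub_le_iff.2 ⟨by linarith, by linarith⟩
  · refine hausdorffDist_le_of_infDist dist_nonneg
      (fun x hx => infDist_le_dist_supportFn A B hx) fun x hx => ?_
    rw [dist_comm]
    exact infDist_le_dist_supportFn B A hx

theorem supportFn_eq_of_coe_eq_closure {A B C : CB L} {a b : ℝ} (ha : 0 ≤ a) (hb : 0 ≤ b)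
    (hC : (C : Set L) = closure (a • (A : Set L) + b • (B : Set L))) :
    supportFn C = a • supportFn A + b • supportFn B := by
  ext φ
  refine (isLUB_supportFn C φ).unique ?_
  have hS : IsLUB (φ.1 '' (a • (A : Set L) + b • (B : Set L)))
      (a * supportFn A φ + b * supportFn B φ) := by
    rw [image_add, image_smul_set, image_smul_set]
    simpa only [← image_smul, smul_eq_mul] using
      ((isLUB_supportFn A φ).mul_left ha).add ((isLUB_supportFn B φ).mul_left hb)
  rw [hC]
  exact (isLUB_iff_of_subset_of_subset_closure (image_mono subset_closure)
    (image_closure_subset_closure_image φ.1.continuous)).1 hS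

theorem convex_range_supportFn : Convex ℝ (range (supportFn (L := L))) := by
  rintro _ ⟨A, rfl⟩ _ ⟨B, rfl⟩ a b ha hb -
  have hbdd : Bornology.IsBounded (a • (A : Set L) + b • (B : Set L)) :=
    (A.isBounded'.smul₀ a).add (B.isBounded'.smul₀ b)
  exact ⟨⟨closure (a • (A : Set L) + b • (B : Set L)),
    ((A.convex'.smul a).add (B.convex'.smul b)).closure, isClosed_closure, hbdd.closure,
    (A.nonempty'.smul_set.add B.nonempty'.smul_set).closure⟩,
    supportFn_eq_of_coe_eq_closure ha hb rfl⟩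

/-! ### The group action on support functions -/

section Action

variable {G : Type*} [Group G] [DistribMulAction G L] [SMulCommClass G ℝ L]
  [IsIsometricSMul G L]

variable (L) in
/-- The action of `g` on `L` as a linear isometry. -/
def smulLinearIsometry (g : G) : L →ₗᵢ[ℝ] L where
  toLinearMap := DistribSMul.toLinearMap ℝ L g
  norm_map' x := by
    have h := dist_smul g x 0
    rwa [smul_zero, dist_zero_right, dist_zero_right] at h

theorem comp_smulLinearIsometry_mem (g : G) (φ : DualBall L) :
    φ.1.comp (smulLinearIsometry L g).toContinuousLinearMap ∈
      closedBall (0 : StrongDual ℝ L) 1 := by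
  rw [mem_closedBall_zero_iff]
  refine ContinuousLinearMap.opNorm_le_bound _ zero_le_one fun x => ?_
  rw [one_mul, ← (smulLinearIsometry L g).norm_map x]
  exact abs_apply_le_norm φ _

variable (L) in
/-- The map `φ ↦ φ ∘ g` of the closed unit ball of the dual. -/
def dualBallPrecomp (g : G) : C(DualBall L, DualBall L) where
  toFun φ := ⟨_, comp_smulLinearIsometry_mem g φ⟩
  continuous_toFun := (continuous_subtype_val.clm_comp continuous_const).subtype_mk _

theorem supportFn_smul (g : G) (A : CB L) :
    supportFn (g • A) =
      BoundedContinuousFunction.compContinuousCLM ℝ ℝ (dualBallPrecomp L g) (supportFn A) := by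
  ext φ
  refine (isLUB_supportFn (g • A) φ).unique ?_
  have h := isLUB_supportFn A (dualBallPrecomp L g φ)
  rw [coe_smul, ← image_smul, image_image]
  exact h

end Action

end CB

/-! ### Compact convex sets -/

namespace ConvexBody

variable {L : Type*} [NormedAddCommGroup L] [NormedSpace ℝ L]

/-- A compact convex set as an element of `CB L`. -/
def toCB (K : ConvexBody L) : CB L := ⟨K, K.convex, K.isClosed, K.isBounded, K.nonempty⟩

theorem isometry_toCB : Isometry (toCB : ConvexBody L → CB L) :=
  Isometry.of_dist_eq fun _ _ => rfl

instance [CompleteSpace L] : CompleteSpace (ConvexBody L) := by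
  have hiso := CB.isometry_toCloseds.comp (isometry_toCB (L := L))
  refine (completeSpace_iff_isComplete_range hiso.isUniformInducing).2 (IsClosed.isComplete ?_)
  -- both ranges on the right are closed in the complete space of closed sets
  have hrange : range (CB.toCloseds ∘ toCB : ConvexBody L → TopologicalSpace.Closeds L) =
      range CB.toCloseds ∩ range TopologicalSpace.NonemptyCompacts.toCloseds := by
    refine Subset.antisymm ?_ ?_
    · rintro _ ⟨K, rfl⟩
      exact ⟨⟨_, rfl⟩, ⟨⟨K, K.isCompact⟩, K.nonempty⟩, rfl⟩
    · rintro _ ⟨⟨A, rfl⟩, K, hK⟩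
      have hcoe : (K : Set L) = A := congrArg (fun C : TopologicalSpace.Closeds L => (C : Set L)) hK
      exact ⟨⟨A, A.convex', hcoe ▸ K.isCompact, A.nonempty'⟩, rfl⟩
  rw [hrange]
  exact CB.isClosed_range_toCloseds.inter
    TopologicalSpace.NonemptyCompacts.isClosedEmbedding_toCloseds.isClosed_range

theorem convex_range_supportFn_toCB :
    Convex ℝ (range fun K : ConvexBody L => K.toCB.supportFn) := by
  rintro _ ⟨A, rfl⟩ _ ⟨B, rfl⟩ a b ha hb -
  refine ⟨a • A + b • B, CB.supportFn_eq_of_coe_eq_closure ha hb ?_⟩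
  exact (a • A + b • B).isClosed.closure_eq.symm

variable {G : Type*} [Group G] [DistribMulAction G L] [SMulCommClass G ℝ L]
  [IsIsometricSMul G L]

theorem dist_smul_smul (g : G) (A B : ConvexBody L) : dist (g • A) (g • B) = dist A B :=
  hausdorffDist_image (isometry_smul L g)

instance [TopologicalSpace G] [ContinuousSMul G L] : ContinuousSMul G (ConvexBody L) := by
  refine ⟨continuous_iff_continuousAt.2 fun ⟨g₀, A₀⟩ => ?_⟩
  -- on the compact set `A₀`, the maps `x ↦ g • x` converge uniformly as `g → g₀`
  have horbit : Tendsto (fun g : G => g • A₀) (𝓝 g₀) (𝓝 (g₀ • A₀)) := by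
    rw [Metric.tendsto_nhds]
    intro ε hε
    have hunif : ∀ᶠ g in 𝓝 g₀, ∀ x ∈ (A₀ : Set L), dist (g • x) (g₀ • x) < ε / 2 := by
      refine A₀.isCompact.eventually_forall_of_forall_eventually fun x _ => ?_
      have hc : Continuous fun p : G × L => dist (p.1 • p.2) (g₀ • p.2) := by fun_prop
      refine hc.continuousAt.eventually_lt continuousAt_const ?_
      simpa using half_pos hε
    filter_upwards [hunif] with g hg
    refine lt_of_le_of_lt ?_ (half_lt_self hε)
    refine hausdorffDist_le_of_mem_dist (half_pos hε).le ?_ ?_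
    · rintro _ ⟨x, hx, rfl⟩
      exact ⟨g₀ • x, smul_mem_smul_set hx, (hg x hx).le⟩
    · rintro _ ⟨x, hx, rfl⟩
      exact ⟨g • x, smul_mem_smul_set hx, by rw [dist_comm]; exact (hg x hx).le⟩
  refine tendsto_iff_dist_tendsto_zero.2 (squeeze_zero (fun _ => dist_nonneg) (fun p => ?_)
    (g := fun p : G × ConvexBody L => dist p.2 A₀ + dist (p.1 • A₀) (g₀ • A₀)) ?_)
  · exact (dist_triangle _ (p.1 • A₀) _).trans_eq (by rw [dist_smul_smul])
  · rw [nhds_prod_eq]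
    simpa using ((tendsto_iff_dist_tendsto_zero.1 tendsto_id).comp tendsto_snd).add
      ((tendsto_iff_dist_tendsto_zero.1 horbit).comp tendsto_fst)

end ConvexBody

/-! ### Equivariant absolute extensors -/

theorem theorem5p1 (G : Type u) [Group G] [TopologicalSpace G] [IsTopologicalGroup G]
    [CompactSpace G]
    (L : Type v) [NormedAddCommGroup L] [NormedSpace ℝ L] [CompleteSpace L]
    [DistribMulAction G L] [SMulCommClass G ℝ L] [IsIsometricSMul G L] [ContinuousSMul G L] :
    IsGAE.{w} G (ConvexBody L) ∧ (ContinuousSMul G (CB L) → IsGAE.{w} G (CB L)) := by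
  refine ⟨?_, fun _ => ?_⟩
  · exact IsGAE.of_isometry_of_convex_range (fun K => K.toCB.supportFn)
      (CB.isometry_supportFn.comp ConvexBody.isometry_toCB)
      ConvexBody.convex_range_supportFn_toCB _ fun g K => CB.supportFn_smul g K.toCB
  · exact IsGAE.of_isometry_of_convex_range CB.supportFn CB.isometry_supportFn
      CB.convex_range_supportFn _ CB.supportFn_smul
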